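/- Let $d\ge 2$, let $U$ be a unitary operator on $\mathbb{C}^d$, and let $\Pi=\{\Pi_1,\dots,\Pi_k\}$ be a rank-$1$ POVM on $\mathbb{C}^d$, i.e. a family of (non-zero) positive semi-definite operators with $\sum_{i=1}^k\Pi_i=\mathbb{I}$, $\operatorname{rank}\Pi_i=1$ for every $i$, and $\operatorname{tr}\Pi_1=\dots=\operatorname{tr}\Pi_k$. Let $\varphi_1,\dots,\varphi_k\in\mathbb{C}^d$ be unit vectors with $\operatorname{im}\Pi_i=\operatorname{span}\{\varphi_i\}$, and let $\rho_i$ be the orthogonal projection onto $\operatorname{span}\{\varphi_i\}$. For an operator $\rho$ put $\mathsf{p}_j(\rho):=\operatorname{tr}(\Pi_jU\rho U^*)$. Let $\mathbb{P}_*$ be the unique probability measure on $\{1,\dots,k\}^{\mathbb{N}}$, with the $\sigma$-algebra generated by the cylinder sets, such that for all $n$ and all $i_1,\dots,i_n\in\{1,\dots,k\}$ $$\mathbb{P}_*\big(\{s: s_1=i_1,\dots,s_n=i_n\}\big)=\operatorname{tr}\Big(\sqrt{\Pi_{i_n}}\,U\cdots\sqrt{\Pi_{i_1}}\,U\,\tfrac{\mathbb{I}}{d}\,U^*\sqrt{\Pi_{i_1}}\cdots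 U^*\sqrt{\Pi_{i_n}}\Big).$$ The following conditions are equivalent: (i) $\mathbb{P}_*$ is ergodic with respect to the left shift $(s_n)_n\mapsto(s_{n+1})_n$; (ii) $\{\sqrt{\Pi_1}U,\dots,\sqrt{\Pi_k}U\}$ is irreducible, i.e. no subspace of $\mathbb{C}^d$ other than $\{0\}$ and $\mathbb{C}^d$ is invariant under all of these operators; (iii) there is no subspace $W$ of $\mathbb{C}^d$ other than $\{0\}$ and $\mathbb{C}^d$ such that $U(W)=W$ and $\varphi_i\in W\cup W^\perp$ for every $i\in\{1,\dots,k\}$; (iv) the transition matrix $[\mathsf{p}_j(\rho_i)]_{i,j=1}^k$ is irreducible, i.e. it is a matrix with non-negative entries such that for all $i,j$ some positive power of it has a positive $(i,j)$ entry. -/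

import Mathlib

open MeasureTheory ProbabilityTheory
open scoped ENNReal NNReal

noncomputable section

namespace QTraj

/-! ### The shift space -/

/-- The cylinder set of one-sided sequences that start with the string `l`. -/
def cylinder {α : Type*} (l : List α) : Set (ℕ → α) :=
  {s | ∀ m : Fin l.length, s m = l.get m}

/-- The left shift on one-sided sequences. -/
def shift {α : Type*} (s : ℕ → α) : ℕ → α := fun n => s (n + 1)

section Extension

variable {α : Type*}

/-- The string formed by a finite history. -/
def hist (n : ℕ) (x : (i : Finset.Iic n) → α) : List α :=
  List.ofFn fun i : Fin (n + 1) => x ⟨i, Finset.mem_Iic.2 (Nat.lt_succ_iff.1 i.2)⟩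

theorem mem_cylinder_iff_hist (n : ℕ) (x : (i : Finset.Iic n) → α) (s : ℕ → α) :
    s ∈ cylinder (hist n x) ↔ Preorder.frestrictLe n s = x := by
  constructor
  · intro h
    funext ⟨i, hi⟩
    have := h ⟨i, by simpa [hist] using Nat.lt_succ_iff.2 (Finset.mem_Iic.1 hi)⟩
    simpa [hist, -List.ofFn_succ] using this
  · rintro rfl ⟨m, hm⟩
    simp [hist, -List.ofFn_succ]

theorem exists_hist_eq (l : List α) (n : ℕ) (hl : l.length = n + 1) :
    ∃ x : (i : Finset.Iic n) → α, hist n x = l := by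
  refine ⟨fun i => l.get ⟨i, by have := Finset.mem_Iic.1 i.2; omega⟩, ?_⟩
  apply List.ext_getElem
  · simp [hist, hl]
  · intro i h1 h2
    simp [hist, -List.ofFn_succ]

variable [Fintype α] [MeasurableSpace α]

/-- The law of the next symbol of a random sequence whose strings have the probabilities `w`. -/
def stepMeasure (w : List α → ℝ≥0) (b : α) (l : List α) : Measure α :=
  open Classical in
  if w l = 0 then Measure.dirac b
  else ∑ a, ((w (l ++ [a]) / w l : ℝ≥0) : ℝ≥0∞) • Measure.dirac a

theorem stepMeasure_prob (w : List α → ℝ≥0) (hw : ∀ l, ∑ a, w (l ++ [a]) = w l)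
    (b : α) (l : List α) : IsProbabilityMeasure (stepMeasure w b l) := by
  unfold stepMeasure
  split_ifs with h
  · infer_instance
  · constructor
    simp only [Measure.coe_finsetSum, Finset.sum_apply, Measure.smul_apply, measure_univ,
      smul_eq_mul, mul_one]
    rw [← ENNReal.ofNNReal_finsetSum, ← Finset.sum_div, hw l, div_self h, ENNReal.coe_one]

theorem mul_stepMeasure [MeasurableSingletonClass α] (w : List α → ℝ≥0) (hw : ∀ l, ∑ a, w (l ++ [a]) = w l)
    (b : α) (l : List α) (a : α) :
    (w l : ℝ≥0∞) * stepMeasure w b l {a} = w (l ++ [a]) := by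
  classical
  unfold stepMeasure
  split_ifs with h
  · have := hw l
    rw [h, Finset.sum_eq_zero_iff] at this
    rw [h, this a (Finset.mem_univ a)]; simp
  · simp only [Measure.coe_finsetSum, Finset.sum_apply, Measure.smul_apply, smul_eq_mul]
    rw [Finset.sum_eq_single a]
    · simp only [Measure.dirac_apply, Set.mem_singleton_iff, Set.indicator_of_mem, Pi.one_apply,
        mul_one]
      rw [← ENNReal.coe_mul, mul_div_cancel₀ _ h]
    · intro c _ hc
      simp [hc]
    · simp

/-- Consistent probabilities of strings extend to a unique measure on the space of sequences. -/
theorem existsUnique_measure [MeasurableSingletonClass α] (w : List α → ℝ≥0) (h0 : w [] = 1)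
    (hw : ∀ l, ∑ a, w (l ++ [a]) = w l) :
    ∃! P : Measure (ℕ → α), ∀ l, P (cylinder l) = w l := by
  classical
  have hne : Nonempty α := by
    by_contra h
    have := hw []
    rw [not_nonempty_iff] at h
    simp [h0] at this
  obtain ⟨b⟩ := hne
  have hnil : cylinder ([] : List α) = Set.univ := by
    ext s; simp [cylinder]
  have hdisc : ∀ n : ℕ, DiscreteMeasurableSpace ((i : Finset.Iic n) → α) := fun n => inferInstance
  have hpre : ∀ n, ∀ x : (i : Finset.Iic n) → α,
      cylinder (hist n x) = Preorder.frestrictLe (π := fun _ => α) n ⁻¹' {x} := by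
    intro n x; ext s; rw [mem_cylinder_iff_hist]; rfl
  refine existsUnique_of_exists_of_unique ?_ ?_
  · let κ : (n : ℕ) → Kernel ((i : Finset.Iic n) → α) α := fun n =>
      Kernel.ofFunOfCountable fun x => stepMeasure w b (hist n x)
    have hκ : ∀ n, IsMarkovKernel (κ n) := fun n =>
      ⟨fun x => stepMeasure_prob w hw b _⟩
    have hμ := stepMeasure_prob w hw b []
    let P : Measure (ℕ → α) := Kernel.trajMeasure (X := fun _ => α) (stepMeasure w b []) κ
    have hP : IsProbabilityMeasure P := by
      change IsProbabilityMeasure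
        (Kernel.trajMeasure (X := fun _ => α) (stepMeasure w b []) κ)
      infer_instance
    have hstep : ∀ n : ℕ, P.map (Preorder.frestrictLe n) ⊗ₘ κ n =
        P.map (fun x => (Preorder.frestrictLe n x, x (n + 1))) := fun n =>
      Kernel.map_frestrictLe_trajMeasure_compProd_eq_map_trajMeasure
    have hbase : P.map (Preorder.frestrictLe 0) = (stepMeasure w b []).map
        (MeasurableEquiv.piUnique (fun _ : Finset.Iic 0 => α)).symm := by
      change (Kernel.trajMeasure (X := fun _ => α) (stepMeasure w b []) κ).map _ = _
      rw [Kernel.trajMeasure, Measure.map_comp _ _ (by fun_prop), Kernel.traj_map_frestrictLe,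
        Kernel.partialTraj_self, Measure.id_comp]
    have key : ∀ n, ∀ x : (i : Finset.Iic n) → α, P (cylinder (hist n x)) = w (hist n x) := by
      have hmap : ∀ n, ∀ x : (i : Finset.Iic n) → α,
          P (cylinder (hist n x)) = P.map (Preorder.frestrictLe n) {x} := by
        intro n x
        rw [Measure.map_apply (by fun_prop) (measurableSet_singleton x), hpre]
      intro n
      induction n with
      | zero =>
        intro x
        rw [hmap, hbase, Measure.map_apply (MeasurableEquiv.measurable _)
          (measurableSet_singleton x)]
        have : (MeasurableEquiv.piUnique (fun _ : Finset.Iic 0 => α)).symm ⁻¹' {x}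
            = {x ⟨0, by simp⟩} := by
          ext a
          simp only [Set.mem_preimage, Set.mem_singleton_iff]
          constructor
          · rintro rfl; rfl
          · rintro rfl
            funext ⟨i, hi⟩
            obtain rfl : i = 0 := by simpa using hi
            rfl
        rw [this]
        have h2 := mul_stepMeasure w hw b [] (x ⟨0, by simp⟩)
        rw [h0, ENNReal.coe_one, one_mul] at h2
        rw [h2]
        rfl
      | succ n ih =>
        intro x
        let y : (i : Finset.Iic n) → α := fun i =>
          x ⟨i, Finset.mem_Iic.2 ((Finset.mem_Iic.1 i.2).trans n.le_succ)⟩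
        let a : α := x ⟨n + 1, by simp⟩
        have hx : hist (n + 1) x = hist n y ++ [a] := by
          unfold hist
          rw [List.ofFn_succ_last]
          rfl
        have hset : cylinder (hist (n + 1) x) =
            (fun s : ℕ → α => (Preorder.frestrictLe (π := fun _ => α) n s, s (n + 1))) ⁻¹'
              ({y} ×ˢ {a}) := by
          ext s
          rw [mem_cylinder_iff_hist]
          simp only [Set.mem_preimage, Set.mem_prod, Set.mem_singleton_iff]
          constructor
          · rintro rfl; exact ⟨rfl, rfl⟩
          · rintro ⟨h1, h2⟩
            funext ⟨i, hi⟩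
            rcases Nat.lt_or_ge n i with h | h
            · obtain rfl : i = n + 1 := by have := Finset.mem_Iic.1 hi; omega
              exact h2
            · exact congrFun h1 ⟨i, Finset.mem_Iic.2 h⟩
        rw [hset, ← Measure.map_apply (by fun_prop)
          ((measurableSet_singleton y).prod (measurableSet_singleton a)), ← hstep,
          Measure.compProd_apply_prod (measurableSet_singleton y) (measurableSet_singleton a),
          lintegral_singleton, ← hmap, ih y, mul_comm, hx]
        exact mul_stepMeasure w hw b (hist n y) a
    refine ⟨P, fun l => ?_⟩
    rcases l with _ | ⟨a, l⟩
    · rw [hnil, h0, measure_univ]; rfl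
    · obtain ⟨x, hx⟩ := exists_hist_eq (a :: l) l.length rfl
      rw [← hx]
      exact key _ x
  · intro P Q hP hQ
    have hPp : IsProbabilityMeasure P := ⟨by rw [← hnil, hP, h0]; rfl⟩
    have hQp : IsProbabilityMeasure Q := ⟨by rw [← hnil, hQ, h0]; rfl⟩
    let F : (I : Finset ℕ) → Measure ((i : I) → α) := fun I => Q.map I.restrict
    have hQF : IsProjectiveLimit Q F := fun I => rfl
    have hF : IsProjectiveMeasureFamily (α := fun _ => α) F := by
      intro I J hJI
      change Q.map J.restrict = (Q.map I.restrict).map (Finset.restrict₂ (π := fun _ => α) hJI)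
      rw [Measure.map_map (by fun_prop) (by fun_prop)]
      rfl
    have hFfin : ∀ I, IsFiniteMeasure (F I) := fun I => by
      change IsFiniteMeasure (Q.map I.restrict); infer_instance
    have hPF : IsProjectiveLimit P F := by
      refine (isProjectiveLimit_nat_iff (X := fun _ => α) hF P).2 fun n => ?_
      refine Measure.ext_of_singleton fun x => ?_
      change P.map (Preorder.frestrictLe n) {x} = Q.map (Preorder.frestrictLe n) {x}
      rw [Measure.map_apply (by fun_prop) (measurableSet_singleton x),
        Measure.map_apply (by fun_prop) (measurableSet_singleton x), ← hpre, hP, hQ]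
    exact hPF.unique hQF

end Extension

/-! ### Repeated measurements of a unitarily evolving system -/

/-- The Hilbert space `ℂ^d`. -/
abbrev H (d : ℕ) : Type := EuclideanSpace ℂ (Fin d)

/-- The algebra of linear operators on `ℂ^d`; `1` is the identity, `star` the adjoint,
`*` the composition. -/
abbrev Op (d : ℕ) : Type := H d →L[ℂ] H d

variable {d k : ℕ}

/-- The trace of an operator on `ℂ^d`. -/
def tr (A : Op d) : ℂ := LinearMap.trace ℂ (H d) (A : H d →ₗ[ℂ] H d)

/-- A positive operator-valued measure with `k` outcomes on `ℂ^d`. -/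
structure IsPOVM (E : Fin k → Op d) : Prop where
  pos : ∀ i, (E i).IsPositive
  ne_zero : ∀ i, E i ≠ 0
  sum_eq_one : ∑ i, E i = 1

/-- A (normalised) rank-1 POVM: all elements have rank 1 and the same trace. -/
structure IsRankOnePOVM (E : Fin k → Op d) : Prop extends IsPOVM E where
  tr_eq : ∀ i j, tr (E i) = tr (E j)
  rank_eq_one : ∀ i, Module.finrank ℂ (LinearMap.range (E i : H d →ₗ[ℂ] H d)) = 1

/-- The operator `√E_i U`, with the positive square root. -/
def measOp (U : unitary (Op d)) (E : Fin k → Op d) (i : Fin k) : Op d :=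
  CFC.sqrt (E i) * (U : Op d)

/-- The maximally mixed state `ρ_* = I / d`. -/
def maxMixed (d : ℕ) : Op d := (d : ℂ)⁻¹ • 1

/-- The probability `p_j(ρ) = tr (E_j U ρ U^*)` of the outcome `j` in the state `ρ`
(a real number whenever `ρ` and `E_j` are positive). -/
def outcomeProb (U : unitary (Op d)) (E : Fin k → Op d) (j : Fin k) (ρ : Op d) : ℝ :=
  (tr (E j * (U : Op d) * ρ * star (U : Op d))).re

/-- The unnormalised state transformation `Λ_i(ρ) = √E_i U ρ U^* √E_i`. -/
def Lam (U : unitary (Op d)) (E : Fin k → Op d) (i : Fin k) (ρ : Op d) : Op d :=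
  CFC.sqrt (E i) * (U : Op d) * ρ * star (U : Op d) * CFC.sqrt (E i)

/-- `Λ_{i_n} ⋯ Λ_{i_1} (ρ)` for the string `(i_1, …, i_n)`. -/
def LamString (U : unitary (Op d)) (E : Fin k → Op d) (l : List (Fin k)) (ρ : Op d) : Op d :=
  l.foldl (fun σ i => Lam U E i σ) ρ

/-- The probability `p_ι(ρ) = tr (√E_{i_n} U ⋯ √E_{i_1} U ρ U^* √E_{i_1} ⋯ U^* √E_{i_n})` of the
string `ι = (i_1, …, i_n)` of outcomes, for the initial state `ρ`. -/
def stringProb (U : unitary (Op d)) (E : Fin k → Op d) (l : List (Fin k)) (ρ : Op d) : ℝ :=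
  (tr (LamString U E l ρ)).re

theorem Lam_nonneg (U : unitary (Op d)) (E : Fin k → Op d) (i : Fin k) {ρ : Op d} (hρ : 0 ≤ ρ) :
    0 ≤ Lam U E i ρ := by
  have h := star_right_conjugate_nonneg hρ (CFC.sqrt (E i) * (U : Op d))
  have hs : star (CFC.sqrt (E i)) = CFC.sqrt (E i) :=
    (IsSelfAdjoint.of_nonneg (CFC.sqrt_nonneg (E i))).star_eq
  rw [star_mul, hs] at h
  simpa only [Lam, mul_assoc] using h

theorem LamString_nonneg (U : unitary (Op d)) (E : Fin k → Op d) (l : List (Fin k)) {ρ : Op d}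
    (hρ : 0 ≤ ρ) : 0 ≤ LamString U E l ρ := by
  induction l generalizing ρ with
  | nil => exact hρ
  | cons i l ih => exact ih (Lam_nonneg U E i hρ)

theorem tr_mul_comm (A B : Op d) : tr (A * B) = tr (B * A) :=
  LinearMap.trace_mul_comm ℂ (A : H d →ₗ[ℂ] H d) (B : H d →ₗ[ℂ] H d)

theorem tr_sum {ι : Type*} (s : Finset ι) (A : ι → Op d) :
    tr (∑ i ∈ s, A i) = ∑ i ∈ s, tr (A i) := by
  unfold tr
  rw [← map_sum]
  congr 1
  ext x
  simp

open scoped ComplexOrder in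
theorem tr_re_nonneg {A : Op d} (hA : 0 ≤ A) : 0 ≤ (tr A).re := by
  have h := (ContinuousLinearMap.nonneg_iff_isPositive A).1 hA
  have h2 := h.toLinearMap.trace_nonneg
  exact (Complex.nonneg_iff.1 h2).1

theorem sum_tr_Lam {E : Fin k → Op d} (hE : IsPOVM E) (U : unitary (Op d)) (ρ : Op d) :
    ∑ i, tr (Lam U E i ρ) = tr ρ := by
  have h1 : ∀ i, tr (Lam U E i ρ) = tr (E i * ((U : Op d) * ρ * star (U : Op d))) := by
    intro i
    have hi : 0 ≤ E i := (ContinuousLinearMap.nonneg_iff_isPositive _).2 (hE.pos i)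
    rw [Lam, tr_mul_comm]
    simp only [← mul_assoc]
    rw [CFC.sqrt_mul_sqrt_self (E i) hi]
  simp only [h1]
  rw [← tr_sum, ← Finset.sum_mul, hE.sum_eq_one, one_mul, tr_mul_comm, ← mul_assoc,
    Unitary.coe_star_mul_self, one_mul]

open scoped ComplexOrder in
theorem maxMixed_nonneg (d : ℕ) : 0 ≤ maxMixed d := by
  unfold maxMixed
  rw [ContinuousLinearMap.nonneg_iff_isPositive]
  refine ContinuousLinearMap.IsPositive.smul_of_nonneg ?_ ?_
  · exact ContinuousLinearMap.isPositive_one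
  · rw [← Complex.ofReal_natCast, ← Complex.ofReal_inv]
    exact Complex.zero_le_real.2 (by positivity)

theorem tr_maxMixed (hd : 0 < d) : tr (maxMixed d) = 1 := by
  have : tr (1 : Op d) = d := by
    simp [tr]
  have h2 : tr (maxMixed d) = (d : ℂ)⁻¹ * tr (1 : Op d) := by
    simp [tr, maxMixed]
  rw [h2, this, inv_mul_cancel₀ (by exact_mod_cast hd.ne')]

/-- There is exactly one measure on the space of sequences of outcomes that gives every cylinder
set the probability of the corresponding string of outcomes for the initial state `ρ_*`. -/
theorem existsUnique_outcomeMeasure (hd : 0 < d) (U : unitary (Op d)) {E : Fin k → Op d}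
    (hE : IsPOVM E) : ∃! P : Measure (ℕ → Fin k),
      ∀ l, P (cylinder l) = ENNReal.ofReal (stringProb U E l (maxMixed d)) := by
  refine existsUnique_measure (fun l => (stringProb U E l (maxMixed d)).toNNReal) ?_ ?_
  · simp [stringProb, LamString, tr_maxMixed hd]
  · intro l
    have hpos := LamString_nonneg U E l (maxMixed_nonneg d)
    rw [← Real.toNNReal_sum_of_nonneg]
    · congr 1
      have h := congrArg Complex.re (sum_tr_Lam hE U (LamString U E l (maxMixed d)))
      rw [Complex.re_sum] at h
      simpa [stringProb, LamString] using h
    · intro i _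
      exact tr_re_nonneg (LamString_nonneg U E _ (maxMixed_nonneg d))

/-- The measure `P_*` on the space of sequences of outcomes. -/
def outcomeMeasure (hd : 0 < d) (U : unitary (Op d)) {E : Fin k → Op d} (hE : IsPOVM E) :
    Measure (ℕ → Fin k) :=
  (existsUnique_outcomeMeasure hd U hE).choose

/-- The defining property of `P_*`. -/
theorem outcomeMeasure_cylinder (hd : 0 < d) (U : unitary (Op d)) {E : Fin k → Op d}
    (hE : IsPOVM E) (l : List (Fin k)) :
    outcomeMeasure hd U hE (cylinder l) = ENNReal.ofReal (stringProb U E l (maxMixed d)) :=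
  (existsUnique_outcomeMeasure hd U hE).choose_spec.1 l

/-- A family of operators is irreducible if no subspace other than `0` and `ℂ^d` is invariant
under all of them. -/
def IrreducibleFamily (A : Fin k → Op d) : Prop :=
  ¬ ∃ W : Submodule ℂ (H d), W ≠ ⊥ ∧ W ≠ ⊤ ∧ ∀ i, ∀ x ∈ W, A i x ∈ W

/-- The orthogonal projection onto the line spanned by `v`. -/
def lineProj (v : H d) : Op d := (Submodule.span ℂ {v}).starProjection

/-- The matrix `[p_j(ρ_i)]`, where `ρ_i` is the orthogonal projection onto the line of `φ_i`. -/
def transitionMatrix (U : unitary (Op d)) (E : Fin k → Op d) (φ : Fin k → H d) :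
    Matrix (Fin k) (Fin k) ℝ :=
  Matrix.of fun i j => outcomeProb U E j (lineProj (φ i))

end QTraj

end

/-! Equal traces and rank one give `E i = c |φ i⟩⟨φ i|` with one constant `c > 0`. Outcome `i`
therefore leaves the system in the state `ρ_i`, whatever happened before, and the outcomes form a
Markov chain with transition matrix `T i j = c |⟨φ j, U φ i⟩|²` (`Lam_rankOne`). Started from `I /
d`, its initial law is the constant `c / d`. Since `∑ E i = 1` and `U` is unitary, `T` is doubly
stochastic, so this law is stationary, and it has full support.

(i) ⇔ (iv) is then the classical fact that a finite stationary chain of full support is ergodic iff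
it is irreducible: harmonic functions of an irreducible chain are constant, and a closed set of
states yields an almost surely forward-invariant event.

(ii) ⇔ (iii) and (iv) ⇔ (iii) rest on the expansion `x = ∑ c ⟨φ i, x⟩ φ i`: a vector lies in `W` as
soon as every `φ i` not orthogonal to it does (`mem_of_forall_inner_ne_zero`). It turns invariance
under the measurement operators, or closedness of a set of states, into `U W ⊆ W`. In finite
dimension this is `U W = W`, which forces the remaining `φ i` to be orthogonal to `W`. -/

namespace QTraj

/-! ### Irreducible matrices and the maximum principle -/

section Irreducible

variable {n : Type*}

/-- A non-negative matrix without zero rows is irreducible iff no proper non-empty set of states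
is closed under the transitions of positive weight. -/
theorem isIrreducible_iff_forall_closed {T : Matrix n n ℝ} (h0 : ∀ i j, 0 ≤ T i j)
    (hrow : ∀ i, ∃ j, 0 < T i j) :
    T.IsIrreducible ↔ ∀ S : Set n, S.Nonempty → (∀ i ∈ S, ∀ j, 0 < T i j → j ∈ S) →
      S = Set.univ := by
  let : Quiver n := T.toQuiver
  constructor
  · rintro h S ⟨i, hi⟩ hS
    refine Set.eq_univ_of_forall fun j => ?_
    obtain ⟨q, -⟩ := h.connected i j
    induction q with
    | nil => exact hi
    | cons q e ih => exact hS _ ih _ e.down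
  · intro h
    refine ⟨h0, fun i j => ?_⟩
    -- Irreducibility demands paths of positive length, so the empty path at `i` does not count and
    -- `hrow` has to supply a first step.
    have := h {j | ∃ q : Quiver.Path i j, 0 < q.length} ?_ ?_
    · exact (this ▸ Set.mem_univ j : j ∈ {j | ∃ q : Quiver.Path i j, 0 < q.length})
    · obtain ⟨j, hj⟩ := hrow i
      exact ⟨j, Quiver.Path.nil.cons ⟨hj⟩, by simp⟩
    · rintro a ⟨q, hq⟩ b hb
      exact ⟨q.cons ⟨hb⟩, by simp⟩

variable [Fintype n]

theorem exists_pos_of_sum_eq_one {f : n → ℝ} (h : ∑ j, f j = 1) : ∃ j, 0 < f j := by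
  by_contra! h'
  have : ∑ j, f j ≤ 0 := Finset.sum_nonpos fun j _ => h' j
  linarith

/-- The maximum principle: harmonic functions of an irreducible stochastic matrix are constant. -/
theorem eq_of_harmonic {T : Matrix n n ℝ} (hT : T.IsIrreducible) (hrow : ∀ i, ∑ j, T i j = 1)
    {g : n → ℝ} (hg : ∀ i, g i = ∑ j, T i j * g j) (i j : n) : g i = g j := by
  obtain ⟨a, -, ha⟩ := Finset.exists_max_image Finset.univ g ⟨i, Finset.mem_univ i⟩
  -- The set where `g` is maximal is closed: at such a state the weighted deficits `g a - g c ≥ 0`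
  -- sum to zero, so each of them vanishes.
  have hS := (isIrreducible_iff_forall_closed hT.nonneg fun i =>
    exists_pos_of_sum_eq_one (hrow i)).1 hT {b | g b = g a} ⟨a, rfl⟩ ?_
  · have h : ∀ b, g b = g a := fun b => (hS ▸ Set.mem_univ b : b ∈ {b | g b = g a})
    rw [h i, h j]
  · intro b (hb : g b = g a) c hc
    have hsum : ∑ c, T b c * (g a - g c) = 0 := by
      simp only [mul_sub, Finset.sum_sub_distrib, ← Finset.sum_mul, hrow, ← hg, hb]
      ring
    rw [Finset.sum_eq_zero_iff_of_nonneg fun c hc' =>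
      mul_nonneg (hT.nonneg b c) (sub_nonneg.2 (ha c hc'))] at hsum
    rcases mul_eq_zero.1 (hsum c (Finset.mem_univ c)) with h | h
    · exact absurd h hc.ne'
    · exact (sub_eq_zero.1 h).symm

end Irreducible

/-! ### Cylinder sets and the shift -/

section Cylinder

variable {α : Type*}

@[simp]
theorem cylinder_nil : cylinder ([] : List α) = Set.univ := by
  ext s; simp [cylinder]

theorem mem_cylinder_cons {i : α} {l : List α} {s : ℕ → α} :
    s ∈ cylinder (i :: l) ↔ s 0 = i ∧ shift s ∈ cylinder l := by
  constructor
  · intro h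
    exact ⟨h ⟨0, by simp⟩, fun m => h ⟨m + 1, by simp⟩⟩
  · rintro ⟨h0, h1⟩ ⟨m, hm⟩
    cases m with
    | zero => exact h0
    | succ m => exact h1 ⟨m, by simpa using hm⟩

theorem mem_cylinder_singleton {i : α} {s : ℕ → α} : s ∈ cylinder [i] ↔ s 0 = i := by
  simp [mem_cylinder_cons]

theorem cylinder_cons (i : α) (l : List α) :
    cylinder (i :: l) = cylinder [i] ∩ shift ⁻¹' cylinder l := by
  ext s
  rw [mem_cylinder_cons, Set.mem_inter_iff, mem_cylinder_singleton, Set.mem_preimage]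

theorem cylinder_cons_subset (i : α) (l : List α) : cylinder (i :: l) ⊆ cylinder [i] := by
  rw [cylinder_cons]; exact Set.inter_subset_left

theorem cylinder_cons_inter_singleton_of_ne {i j : α} (h : i ≠ j) (l : List α) :
    cylinder (i :: l) ∩ cylinder [j] = ∅ := by
  ext s
  simp only [Set.mem_inter_iff, mem_cylinder_cons, Set.mem_empty_iff_false, iff_false, not_and]
  rintro ⟨rfl, -⟩ h2
  exact fun _ => h h2

variable [MeasurableSpace α]

theorem measurable_shift : Measurable (shift : (ℕ → α) → ℕ → α) :=
  measurable_pi_lambda _ fun n => measurable_pi_apply (n + 1)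

variable [MeasurableSingletonClass α]

theorem measurableSet_cylinder (l : List α) : MeasurableSet (cylinder l) := by
  have : cylinder l = ⋂ m : Fin l.length, (fun s : ℕ → α => s m) ⁻¹' {l.get m} := by
    ext s; simp [cylinder]
  rw [this]
  exact MeasurableSet.iInter fun m => measurable_pi_apply _ (measurableSet_singleton _)

variable [Fintype α]

/-- Finite measures on the space of sequences that agree on the cylinder sets are equal. -/
theorem ext_of_cylinder {P Q : Measure (ℕ → α)} [IsFiniteMeasure P] [IsFiniteMeasure Q]
    (h : ∀ l, P (cylinder l) = Q (cylinder l)) : P = Q := by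
  let F : (I : Finset ℕ) → Measure ((i : I) → α) := fun I => Q.map I.restrict
  have hF : IsProjectiveMeasureFamily (α := fun _ => α) F := by
    intro I J hJI
    change Q.map J.restrict = (Q.map I.restrict).map (Finset.restrict₂ (π := fun _ => α) hJI)
    rw [Measure.map_map (by fun_prop) (by fun_prop)]
    rfl
  have hFfin : ∀ I, IsFiniteMeasure (F I) := fun I => by
    change IsFiniteMeasure (Q.map I.restrict); infer_instance
  -- Marginals on initial segments suffice. They live on finite spaces, whose points pull back to
  -- cylinders.
  have hPF : IsProjectiveLimit P F := by
    refine (isProjectiveLimit_nat_iff (X := fun _ => α) hF P).2 fun n => ?_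
    refine Measure.ext_of_singleton fun x => ?_
    have hpre : Preorder.frestrictLe (π := fun _ => α) n ⁻¹' {x} = cylinder (hist n x) := by
      ext s; rw [mem_cylinder_iff_hist]; rfl
    change P.map (Preorder.frestrictLe n) {x} = Q.map (Preorder.frestrictLe n) {x}
    rw [Measure.map_apply (by fun_prop) (measurableSet_singleton x),
      Measure.map_apply (by fun_prop) (measurableSet_singleton x), hpre, h]
  exact hPF.unique (ν := Q) fun I => rfl

/-- Decomposition of a set according to the first symbol. -/
theorem measureReal_eq_sum_cylinder_inter (P : Measure (ℕ → α)) [IsFiniteMeasure P]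
    {B : Set (ℕ → α)} (hB : MeasurableSet B) : P.real B = ∑ i, P.real (cylinder [i] ∩ B) := by
  classical
  rw [← measureReal_biUnion_finset]
  · congr 1
    ext s
    simp [mem_cylinder_singleton]
  · intro i _ j _ hij
    refine Set.disjoint_left.2 fun s hi hj => hij ?_
    rw [← mem_cylinder_singleton.1 hi.1, mem_cylinder_singleton.1 hj.1]
  · exact fun i _ => (measurableSet_cylinder _).inter hB

end Cylinder

/-! ### Ergodicity of stationary Markov chains -/

section Markov

/-- The probability that a Markov chain with transition matrix `T` that starts at `i` goes on
with the string `l`. -/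
def pathWeight {α : Type*} (T : Matrix α α ℝ) : α → List α → ℝ
  | _, [] => 1
  | i, j :: l => T i j * pathWeight T j l

variable {α : Type*} [Fintype α] [MeasurableSpace α]

/-- `P` is the law of a stationary Markov chain with transition matrix `T` and initial
distribution `p` of full support. -/
structure IsStationaryMarkov (P : Measure (ℕ → α)) (p : α → ℝ) (T : Matrix α α ℝ) : Prop where
  pos : ∀ i, 0 < p i
  nonneg : ∀ i j, 0 ≤ T i j
  row_sum : ∀ i, ∑ j, T i j = 1
  stationary : ∀ j, ∑ i, p i * T i j = p j
  cylinder_cons : ∀ i l, P.real (cylinder (i :: l)) = p i * pathWeight T i l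

namespace IsStationaryMarkov

variable {P : Measure (ℕ → α)} {p : α → ℝ} {T : Matrix α α ℝ}

theorem cylinder_singleton (h : IsStationaryMarkov P p T) (i : α) :
    P.real (cylinder [i]) = p i := by
  rw [h.cylinder_cons, pathWeight, mul_one]

variable [MeasurableSingletonClass α] [IsProbabilityMeasure P]

theorem measurePreserving_shift (h : IsStationaryMarkov P p T) :
    MeasurePreserving shift P P := by
  refine ⟨measurable_shift, ?_⟩
  have := Measure.isProbabilityMeasure_map (μ := P) (measurable_shift (α := α)).aemeasurable
  refine ext_of_cylinder fun l => ?_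
  rw [Measure.map_apply measurable_shift (measurableSet_cylinder l)]
  cases l with
  | nil => simp
  | cons j m =>
    rw [← measureReal_eq_measureReal_iff, measureReal_eq_sum_cylinder_inter P
      (measurable_shift (measurableSet_cylinder _))]
    simp only [← QTraj.cylinder_cons, h.cylinder_cons, pathWeight, ← mul_assoc, ← Finset.sum_mul,
      h.stationary]

/-- The Markov property for the first transition. -/
theorem cylinder_inter_preimage (h : IsStationaryMarkov P p T) (i : α) {B : Set (ℕ → α)}
    (hB : MeasurableSet B) :
    P.real (cylinder [i] ∩ shift ⁻¹' B) =
      ∑ j, p i * T i j / p j * P.real (cylinder [j] ∩ B) := by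
  classical
  have hc : ∀ j, 0 ≤ p i * T i j / p j := fun j =>
    div_nonneg (mul_nonneg (h.pos i).le (h.nonneg i j)) (h.pos j).le
  -- Both sides are finite measures in `B`, so they need only be compared on cylinders. Dividing by
  -- `p j` replaces the stationary weight of the start `j` by the weight of the transition from `i`
  -- to `j`.
  let Q : Measure (ℕ → α) :=
    ∑ j, (p i * T i j / p j).toNNReal • P.restrict (cylinder [j])
  have hQ : ∀ B, MeasurableSet B →
      Q.real B = ∑ j, p i * T i j / p j * P.real (cylinder [j] ∩ B) := by
    intro B hB
    simp only [Q, Measure.real, Measure.coe_finsetSum, Finset.sum_apply]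
    rw [ENNReal.toReal_sum fun j _ => measure_ne_top _ _]
    refine Finset.sum_congr rfl fun j _ => ?_
    rw [Measure.smul_apply, Measure.restrict_apply hB, Set.inter_comm, ENNReal.smul_def,
      smul_eq_mul, ENNReal.toReal_mul, ENNReal.coe_toReal, Real.coe_toNNReal _ (hc j)]
  have hR : ∀ B, MeasurableSet B → ((P.restrict (cylinder [i])).map shift).real B =
      P.real (cylinder [i] ∩ shift ⁻¹' B) := by
    intro B hB
    rw [map_measureReal_apply measurable_shift hB, measureReal_restrict_apply
      (measurable_shift hB), Set.inter_comm]
  have key : (P.restrict (cylinder [i])).map shift = Q := by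
    refine ext_of_cylinder fun l => ?_
    rw [← measureReal_eq_measureReal_iff, hR _ (measurableSet_cylinder l),
      hQ _ (measurableSet_cylinder l), ← QTraj.cylinder_cons, h.cylinder_cons]
    cases l with
    | nil =>
      simp only [cylinder_nil, Set.inter_univ, h.cylinder_singleton, pathWeight]
      simp_rw [div_mul_cancel₀ _ (h.pos _).ne']
      rw [← Finset.mul_sum, h.row_sum]
    | cons j m =>
      rw [Finset.sum_eq_single j]
      · rw [Set.inter_eq_right.2 (cylinder_cons_subset j m), h.cylinder_cons, pathWeight]
        field_simp [(h.pos j).ne']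
      · intro a _ ha
        rw [Set.inter_comm, cylinder_cons_inter_singleton_of_ne ha.symm]
        simp
      · simp
  rw [← hR B hB, key, hQ B hB]

/-- For an invariant event, the conditional probability given the first symbol is harmonic, hence
constant. By the Markov property the event is then independent of every cylinder, hence of itself,
so its probability is 0 or 1. -/
theorem ergodic_of_isIrreducible (h : IsStationaryMarkov P p T) (hT : T.IsIrreducible) :
    Ergodic shift P := by
  refine ⟨h.measurePreserving_shift, ⟨fun A hA hinv => ?_⟩⟩
  let g : α → ℝ := fun i => P.real (cylinder [i] ∩ A) / p i
  have hpg : ∀ i, P.real (cylinder [i] ∩ A) = p i * g i := fun i =>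
    (mul_div_cancel₀ _ (h.pos i).ne').symm
  have hg : ∀ i, g i = ∑ j, T i j * g j := by
    intro i
    have h1 := h.cylinder_inter_preimage i hA
    rw [hinv, hpg] at h1
    apply mul_left_cancel₀ (h.pos i).ne'
    rw [h1, Finset.mul_sum]
    refine Finset.sum_congr rfl fun j _ => ?_
    rw [hpg]
    field_simp [(h.pos j).ne']
  have hconst := eq_of_harmonic hT h.row_sum hg
  have hsum : ∑ i, p i = 1 := by
    have := measureReal_eq_sum_cylinder_inter P MeasurableSet.univ
    simpa [h.cylinder_singleton] using this.symm
  have hgA : ∀ i, g i = P.real A := by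
    intro i
    rw [measureReal_eq_sum_cylinder_inter P hA]
    simp only [hpg, hconst _ i]
    rw [← Finset.sum_mul, hsum, one_mul]
  -- Invariance of `A` allows the first symbol to be stripped off, leaving the shorter string and
  -- the same `A`.
  have hind : ∀ (l : List α) (i : α), P.real (cylinder (i :: l) ∩ A) =
      P.real (cylinder (i :: l)) * P.real A := by
    intro l
    induction l with
    | nil => intro i; rw [hpg, hgA, h.cylinder_singleton]
    | cons j m ih =>
      intro i
      have h1 : cylinder (i :: j :: m) ∩ A = cylinder [i] ∩ shift ⁻¹' (cylinder (j :: m) ∩ A) := by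
        rw [Set.preimage_inter, hinv, QTraj.cylinder_cons i, Set.inter_assoc]
      rw [h1, h.cylinder_inter_preimage i ((measurableSet_cylinder _).inter hA),
        Finset.sum_eq_single j]
      · rw [← Set.inter_assoc, Set.inter_eq_right.2 (cylinder_cons_subset j m), ih,
          h.cylinder_cons, h.cylinder_cons, pathWeight]
        field_simp [(h.pos j).ne']
      · intro a _ ha
        rw [← Set.inter_assoc, Set.inter_comm (cylinder [a]),
          cylinder_cons_inter_singleton_of_ne ha.symm]
        simp
      · simp
  have key : P.restrict A = P A • P := by
    have : IsFiniteMeasure (P A • P) := Measure.smul_finite P (measure_ne_top P A)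
    refine ext_of_cylinder fun l => ?_
    rw [Measure.restrict_apply (measurableSet_cylinder l), Measure.smul_apply, smul_eq_mul]
    cases l with
    | nil => simp
    | cons i m =>
      rw [mul_comm, ← ENNReal.toReal_eq_toReal_iff' (measure_ne_top _ _)
        (ENNReal.mul_ne_top (measure_ne_top _ _) (measure_ne_top _ _)), ENNReal.toReal_mul]
      exact hind m i
  have hsq : P.real A = P.real A * P.real A := by
    have := congrArg (fun Q : Measure (ℕ → α) => (Q A).toReal) key
    simpa [Measure.real] using this
  rw [Filter.eventuallyConst_set']
  rcases eq_or_ne (P.real A) 0 with h0 | h0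
  · exact .inl (ae_eq_empty.2 ((measureReal_eq_zero_iff).1 h0))
  · have h1 : P.real A = 1 := (mul_eq_left₀ h0).1 hsq.symm
    rw [Measure.real, ENNReal.toReal_eq_one_iff] at h1
    exact .inr (ae_eq_univ.2 ((prob_compl_eq_zero_iff hA).2 h1))

/-- A chain that starts in a closed set `S` almost surely stays there, so the event of starting in
`S` has probability 0 or 1. As every `p i` is positive, a non-empty `S` is everything. -/
theorem isIrreducible_of_ergodic (h : IsStationaryMarkov P p T) (hP : Ergodic shift P) :
    T.IsIrreducible := by
  classical
  refine (isIrreducible_iff_forall_closed h.nonneg fun i =>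
    exists_pos_of_sum_eq_one (h.row_sum i)).2 ?_
  rintro S ⟨a, ha⟩ hS
  let A : Set (ℕ → α) := {s | s 0 ∈ S}
  have hA : MeasurableSet A := measurable_pi_apply 0 S.toFinite.measurableSet
  -- The exceptional sequences make a first transition out of `S`, which has weight zero. This one
  -- inclusion is enough for ergodicity to apply.
  have hle : A ≤ᵐ[P] shift ⁻¹' A := by
    rw [ae_le_set]
    have hsub : A \ shift ⁻¹' A ⊆ ⋃ q : {q : α × α // q.1 ∈ S ∧ q.2 ∉ S},
        cylinder [q.1.1, q.1.2] := by
      rintro s ⟨h0, h1⟩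
      refine Set.mem_iUnion.2 ⟨⟨(s 0, s 1), h0, h1⟩, ?_⟩
      simp [mem_cylinder_cons, shift]
    refine measure_mono_null hsub (measure_iUnion_null ?_)
    rintro ⟨⟨i, j⟩, hi, hj⟩
    rw [← measureReal_eq_zero_iff, h.cylinder_cons]
    have : T i j = 0 := le_antisymm (not_lt.1 fun h' => hj (hS i hi j h')) (h.nonneg i j)
    simp [pathWeight, this]
  rcases hP.ae_empty_or_univ_of_ae_le_preimage hA.nullMeasurableSet hle with h0 | h1
  · exfalso
    have h2 : P A = 0 := by rw [measure_congr h0, measure_empty]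
    have h3 : P (cylinder [a]) = 0 := measure_mono_null
      (fun s hs => by change s 0 ∈ S; rwa [mem_cylinder_singleton.1 hs]) h2
    have h4 := h.cylinder_singleton a
    rw [Measure.real, h3] at h4
    exact (h.pos a).ne h4
  · refine Set.eq_univ_of_forall fun b => ?_
    by_contra hb
    have h2 : P Aᶜ = 0 := by rw [measure_congr h1.compl]; simp
    have h3 : P (cylinder [b]) = 0 := measure_mono_null
      (fun s hs => by change s 0 ∉ S; rwa [mem_cylinder_singleton.1 hs]) h2
    have h4 := h.cylinder_singleton b
    rw [Measure.real, h3] at h4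
    exact (h.pos b).ne h4

theorem ergodic_iff_isIrreducible (h : IsStationaryMarkov P p T) :
    Ergodic shift P ↔ T.IsIrreducible :=
  ⟨h.isIrreducible_of_ergodic, h.ergodic_of_isIrreducible⟩

end IsStationaryMarkov

end Markov

open InnerProductSpace

variable {d k : ℕ}

/-! ### Rank-one operators and the form of a rank-1 POVM -/

section RankOne

theorem tr_rankOne (x y : H d) : tr (rankOne ℂ x y) = inner ℂ y x :=
  trace_rankOne x y

theorem tr_smul (a : ℂ) (A : Op d) : tr (a • A) = a * tr A := by
  simp [tr]

theorem mul_rankOne (A : Op d) (x y : H d) : A * rankOne ℂ x y = rankOne ℂ (A x) y :=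
  comp_rankOne x y A

theorem rankOne_mul (A : Op d) (x y : H d) : rankOne ℂ x y * A = rankOne ℂ x (star A y) :=
  rankOne_comp x y A

theorem lineProj_eq_rankOne {v : H d} (hv : ‖v‖ = 1) : lineProj v = rankOne ℂ v v := by
  ext1 x
  rw [lineProj, Submodule.starProjection_unit_singleton ℂ hv, rankOne_apply]

/-- A positive operator whose range is the line of the unit vector `v` is a multiple of the
projection onto that line. -/
theorem eq_smul_rankOne {A : Op d} (hA : A.IsPositive) {v : H d} (hv : ‖v‖ = 1)
    (hr : LinearMap.range (A : H d →ₗ[ℂ] H d) = Submodule.span ℂ {v}) :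
    A = (((tr A).re : ℝ) : ℂ) • rankOne ℂ v v := by
  have hvv : inner ℂ v v = (1 : ℂ) := inner_self_eq_one_of_norm_eq_one hv
  have hmem : ∀ x, A x = inner ℂ v (A x) • v := by
    intro x
    have : A x ∈ Submodule.span ℂ {v} := hr ▸ LinearMap.mem_range_self _ x
    obtain ⟨a, ha⟩ := Submodule.mem_span_singleton.1 this
    rw [← ha, inner_smul_right, hvv, mul_one]
  have hreal : inner ℂ (A v) v = inner ℂ v (A v) := hA.isSymmetric v v
  have h1 : A = (inner ℂ v (A v) : ℂ) • rankOne ℂ v v := by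
    ext1 x
    -- Symmetry moves `A` onto `v`, and `A v` is a real multiple of `v`.
    have h2 : inner ℂ v (A x) = inner ℂ v (A v) * inner ℂ v x := by
      have h3 : inner ℂ (A v) x = inner ℂ v (A x) := hA.isSymmetric v x
      rw [← h3]
      conv_lhs => rw [hmem v]
      rw [inner_smul_left, inner_conj_symm, hreal]
    rw [hmem x, h2, smul_apply, rankOne_apply, smul_smul]
  have htr : tr A = inner ℂ v (A v) := by
    conv_lhs => rw [h1]
    rw [tr_smul, tr_rankOne, hvv, mul_one]
  have him : (((tr A).re : ℝ) : ℂ) = tr A := by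
    rw [htr]
    refine Complex.conj_eq_iff_re.1 ?_
    rw [inner_conj_symm, hreal]
  rw [him, htr]
  exact h1

/-- The elements of a rank-1 POVM are equal multiples of projections onto lines. -/
theorem IsRankOnePOVM.exists_eq_smul_rankOne {E : Fin k → Op d} (hE : IsRankOnePOVM E)
    {φ : Fin k → H d} (hφ : ∀ i, ‖φ i‖ = 1)
    (hEφ : ∀ i, LinearMap.range (E i : H d →ₗ[ℂ] H d) = Submodule.span ℂ {φ i}) :
    ∃ c : ℝ, 0 < c ∧ ∀ i, E i = (c : ℂ) • rankOne ℂ (φ i) (φ i) := by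
  rcases isEmpty_or_nonempty (Fin k) with h | ⟨⟨a⟩⟩
  -- Without outcomes any positive constant will do.
  · exact ⟨1, one_pos, fun i => h.elim i⟩
  · have h := fun i => eq_smul_rankOne (hE.pos i) (hφ i) (hEφ i)
    refine ⟨(tr (E a)).re, lt_of_le_of_ne ?_ ?_, fun i => ?_⟩
    · exact tr_re_nonneg ((ContinuousLinearMap.nonneg_iff_isPositive _).2 (hE.pos a))
    · intro h0
      apply hE.ne_zero a
      rw [h a, ← h0]
      simp
    · rw [hE.tr_eq a i]
      exact h i

end RankOne

/-! ### The frame of the `φ i`, its Markov chain and its invariant subspaces -/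

section Frame

variable {E : Fin k → Op d} {φ : Fin k → H d} {c : ℝ} {U : unitary (Op d)}

theorem norm_unitary_apply (U : unitary (Op d)) (x : H d) : ‖(U : Op d) x‖ = ‖x‖ :=
  ContinuousLinearMap.norm_map_of_mem_unitary U.2 x

theorem injective_unitary (U : unitary (Op d)) : Function.Injective (U : Op d) := by
  intro x y hxy
  rw [← sub_eq_zero, ← norm_eq_zero, ← norm_unitary_apply U, map_sub, hxy, sub_self, norm_zero]

/-- A subspace that a unitary operator maps into itself is mapped onto itself. -/
theorem map_unitary_eq {W : Submodule ℂ (H d)} (h : ∀ x ∈ W, (U : Op d) x ∈ W) :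
    W.map ((U : Op d) : H d →ₗ[ℂ] H d) = W := by
  refine Submodule.eq_of_le_of_finrank_eq ?_ ?_
  · rintro _ ⟨x, hx, rfl⟩
    exact h x hx
  · exact (Submodule.equivMapOfInjective _ (injective_unitary U) W).finrank_eq.symm

theorem sum_inner_smul (hE : IsPOVM E) (hc : ∀ i, E i = (c : ℂ) • rankOne ℂ (φ i) (φ i))
    (x : H d) : ∑ i, ((c : ℂ) * inner ℂ (φ i) x) • φ i = x := by
  have := congrArg (fun A : Op d => A x) hE.sum_eq_one
  simpa only [hc, sum_apply, smul_apply, rankOne_apply, smul_smul,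
    one_apply_eq_self] using this

theorem sum_norm_inner_sq (hE : IsPOVM E) (hc : ∀ i, E i = (c : ℂ) • rankOne ℂ (φ i) (φ i))
    (x : H d) : ∑ i, c * ‖(inner ℂ (φ i) x : ℂ)‖ ^ 2 = ‖x‖ ^ 2 := by
  have h : inner ℂ x (∑ i, ((c : ℂ) * inner ℂ (φ i) x) • φ i) = (inner ℂ x x : ℂ) := by
    rw [sum_inner_smul hE hc]
  rw [inner_sum, inner_self_eq_norm_sq_to_K] at h
  have h2 : ∀ i, inner ℂ x (((c : ℂ) * inner ℂ (φ i) x) • φ i) =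
      ((c * ‖(inner ℂ (φ i) x : ℂ)‖ ^ 2 : ℝ) : ℂ) := by
    intro i
    rw [inner_smul_right, mul_assoc, ← inner_conj_symm x (φ i), Complex.mul_conj,
      Complex.normSq_eq_norm_sq]
    push_cast
    ring
  simp only [h2] at h
  rw [← Complex.ofReal_sum] at h
  exact Complex.ofReal_injective (by simpa using h)

/-- Only the `φ i` not orthogonal to `x` contribute to the frame expansion of `x`. -/
theorem mem_of_forall_inner_ne_zero (hE : IsPOVM E)
    (hc : ∀ i, E i = (c : ℂ) • rankOne ℂ (φ i) (φ i)) {W : Submodule ℂ (H d)} {x : H d}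
    (h : ∀ i, inner ℂ (φ i) x ≠ (0 : ℂ) → φ i ∈ W) : x ∈ W := by
  rw [← sum_inner_smul hE hc x]
  refine W.sum_mem fun i _ => ?_
  by_cases hi : inner ℂ (φ i) x = (0 : ℂ)
  · simp [hi]
  · exact W.smul_mem _ (h i hi)

theorem sqrt_eq_smul_rankOne (hφ : ∀ i, ‖φ i‖ = 1) (hc0 : 0 < c)
    (hc : ∀ i, E i = (c : ℂ) • rankOne ℂ (φ i) (φ i)) (i : Fin k) :
    CFC.sqrt (E i) = (√c : ℂ) • rankOne ℂ (φ i) (φ i) := by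
  refine CFC.sqrt_unique ?_ ?_
  · rw [hc, smul_mul_smul_comm, (isIdempotentElem_rankOne_self (hφ i)).eq, ← Complex.ofReal_mul,
      Real.mul_self_sqrt hc0.le]
  · rw [ContinuousLinearMap.nonneg_iff_isPositive]
    open scoped ComplexOrder in
    exact (isPositive_rankOne_self (φ i)).smul_of_nonneg
      (Complex.zero_le_real.2 (Real.sqrt_nonneg c))

theorem measOp_apply (hφ : ∀ i, ‖φ i‖ = 1) (hc0 : 0 < c)
    (hc : ∀ i, E i = (c : ℂ) • rankOne ℂ (φ i) (φ i)) (i : Fin k) (x : H d) :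
    measOp U E i x = ((√c : ℂ) * inner ℂ (φ i) ((U : Op d) x)) • φ i := by
  rw [measOp, sqrt_eq_smul_rankOne hφ hc0 hc, mul_apply_eq_comp,
    smul_apply, rankOne_apply, smul_smul]

theorem Lam_eq (hφ : ∀ i, ‖φ i‖ = 1) (hc0 : 0 < c)
    (hc : ∀ i, E i = (c : ℂ) • rankOne ℂ (φ i) (φ i)) (i : Fin k) (ρ : Op d) :
    Lam U E i ρ = ((c : ℂ) * inner ℂ (φ i) (((U : Op d) * ρ * star (U : Op d)) (φ i))) •
      rankOne ℂ (φ i) (φ i) := by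
  have h1 : Lam U E i ρ = CFC.sqrt (E i) * ((U : Op d) * ρ * star (U : Op d)) *
      CFC.sqrt (E i) := by simp only [Lam, mul_assoc]
  rw [h1, sqrt_eq_smul_rankOne hφ hc0 hc, mul_smul_comm, smul_mul_assoc, smul_mul_assoc, smul_smul,
    mul_assoc, mul_rankOne, mul_rankOne, rankOne_apply, map_smul,
    smul_apply, smul_smul, ← Complex.ofReal_mul, Real.mul_self_sqrt hc0.le]

theorem transitionMatrix_apply (hφ : ∀ i, ‖φ i‖ = 1)
    (hc : ∀ i, E i = (c : ℂ) • rankOne ℂ (φ i) (φ i)) (i j : Fin k) :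
    transitionMatrix U E φ i j = c * ‖(inner ℂ (φ j) ((U : Op d) (φ i)) : ℂ)‖ ^ 2 := by
  rw [transitionMatrix, Matrix.of_apply, outcomeProb, lineProj_eq_rankOne (hφ i), hc,
    smul_mul_assoc, smul_mul_assoc, smul_mul_assoc, tr_smul, mul_assoc (rankOne ℂ _ _),
    mul_rankOne, mul_rankOne, rankOne_mul, star_star, tr_rankOne, rankOne_apply,
    inner_smul_right, ← inner_conj_symm ((U : Op d) (φ i)) (φ j), Complex.mul_conj,
    Complex.normSq_eq_norm_sq, ← Complex.ofReal_mul, Complex.ofReal_re]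

/-- This is the source of the Markov property: the measurement retains nothing of the earlier state
but a scalar weight. -/
theorem Lam_rankOne (hφ : ∀ i, ‖φ i‖ = 1) (hc0 : 0 < c)
    (hc : ∀ i, E i = (c : ℂ) • rankOne ℂ (φ i) (φ i)) (i j : Fin k) :
    Lam U E j (rankOne ℂ (φ i) (φ i)) =
      (transitionMatrix U E φ i j : ℂ) • rankOne ℂ (φ j) (φ j) := by
  rw [Lam_eq hφ hc0 hc, transitionMatrix_apply hφ hc, mul_assoc, rankOne_mul, star_star,
    mul_rankOne, rankOne_apply, inner_smul_right,
    ← inner_conj_symm ((U : Op d) (φ i)) (φ j), mul_comm (starRingEnd ℂ _), Complex.mul_conj,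
    Complex.normSq_eq_norm_sq, ← Complex.ofReal_mul]

theorem Lam_maxMixed (hφ : ∀ i, ‖φ i‖ = 1) (hc0 : 0 < c)
    (hc : ∀ i, E i = (c : ℂ) • rankOne ℂ (φ i) (φ i)) (i : Fin k) :
    Lam U E i (maxMixed d) = ((c / d : ℝ) : ℂ) • rankOne ℂ (φ i) (φ i) := by
  rw [Lam_eq hφ hc0 hc, maxMixed, mul_smul_comm, mul_one, smul_mul_assoc,
    Unitary.mul_star_self_of_mem U.2, smul_apply, one_apply_eq_self,
    inner_smul_right, inner_self_eq_one_of_norm_eq_one (hφ i)]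
  push_cast
  rw [mul_one, div_eq_mul_inv]

theorem Lam_smul (i : Fin k) (a : ℂ) (ρ : Op d) : Lam U E i (a • ρ) = a • Lam U E i ρ := by
  simp only [Lam, mul_smul_comm, smul_mul_assoc]

/-- The factor `a` accumulates the transition probabilities during the induction. -/
theorem tr_LamString_rankOne (hφ : ∀ i, ‖φ i‖ = 1) (hc0 : 0 < c)
    (hc : ∀ i, E i = (c : ℂ) • rankOne ℂ (φ i) (φ i)) (l : List (Fin k)) (i : Fin k) (a : ℝ) :
    tr (LamString U E l ((a : ℂ) • rankOne ℂ (φ i) (φ i))) =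
      ((a * pathWeight (transitionMatrix U E φ) i l : ℝ) : ℂ) := by
  induction l generalizing i a with
  | nil =>
    rw [LamString, List.foldl_nil, tr_smul, tr_rankOne, inner_self_eq_one_of_norm_eq_one (hφ i),
      pathWeight]
    simp
  | cons j m ih =>
    have h : LamString U E (j :: m) ((a : ℂ) • rankOne ℂ (φ i) (φ i)) =
        LamString U E m (Lam U E j ((a : ℂ) • rankOne ℂ (φ i) (φ i))) := rfl
    rw [h, Lam_smul, Lam_rankOne hφ hc0 hc, smul_smul, ← Complex.ofReal_mul, ih, pathWeight,
      mul_assoc]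

theorem stringProb_cons (hφ : ∀ i, ‖φ i‖ = 1) (hc0 : 0 < c)
    (hc : ∀ i, E i = (c : ℂ) • rankOne ℂ (φ i) (φ i)) (i : Fin k) (l : List (Fin k)) :
    stringProb U E (i :: l) (maxMixed d) =
      c / d * pathWeight (transitionMatrix U E φ) i l := by
  have h : LamString U E (i :: l) (maxMixed d) = LamString U E l (Lam U E i (maxMixed d)) := rfl
  rw [stringProb, h, Lam_maxMixed hφ hc0 hc, tr_LamString_rankOne hφ hc0 hc, Complex.ofReal_re]

theorem transitionMatrix_nonneg (hφ : ∀ i, ‖φ i‖ = 1) (hc0 : 0 < c)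
    (hc : ∀ i, E i = (c : ℂ) • rankOne ℂ (φ i) (φ i)) (i j : Fin k) :
    0 ≤ transitionMatrix U E φ i j := by
  rw [transitionMatrix_apply hφ hc]
  positivity

theorem transitionMatrix_pos_iff (hφ : ∀ i, ‖φ i‖ = 1) (hc0 : 0 < c)
    (hc : ∀ i, E i = (c : ℂ) • rankOne ℂ (φ i) (φ i)) (i j : Fin k) :
    0 < transitionMatrix U E φ i j ↔ inner ℂ (φ j) ((U : Op d) (φ i)) ≠ (0 : ℂ) := by
  rw [transitionMatrix_apply hφ hc, mul_pos_iff_of_pos_left hc0, sq_pos_iff, norm_ne_zero_iff]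

theorem transitionMatrix_row_sum (hE : IsPOVM E) (hφ : ∀ i, ‖φ i‖ = 1)
    (hc : ∀ i, E i = (c : ℂ) • rankOne ℂ (φ i) (φ i)) (i : Fin k) :
    ∑ j, transitionMatrix U E φ i j = 1 := by
  simp only [transitionMatrix_apply hφ hc]
  rw [sum_norm_inner_sq hE hc, norm_unitary_apply, hφ, one_pow]

/-- Moving `U` to the other side of the inner product turns columns into rows of the matrix for
`star U`. This makes the uniform distribution stationary. -/
theorem transitionMatrix_col_sum (hE : IsPOVM E) (hφ : ∀ i, ‖φ i‖ = 1)
    (hc : ∀ i, E i = (c : ℂ) • rankOne ℂ (φ i) (φ i)) (j : Fin k) :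
    ∑ i, transitionMatrix U E φ i j = 1 := by
  have h : ∀ i, transitionMatrix U E φ i j =
      c * ‖(inner ℂ (φ i) (((star U : unitary (Op d)) : Op d) (φ j)) : ℂ)‖ ^ 2 := by
    intro i
    rw [transitionMatrix_apply hφ hc, norm_inner_symm, Unitary.coe_star,
      ContinuousLinearMap.star_eq_adjoint, ContinuousLinearMap.adjoint_inner_right]
  simp only [h]
  rw [sum_norm_inner_sq hE hc, norm_unitary_apply, hφ, one_pow]

instance outcomeMeasure_isProbabilityMeasure (hd : 0 < d) (hE : IsPOVM E) :
    IsProbabilityMeasure (outcomeMeasure hd U hE) := by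
  constructor
  rw [← cylinder_nil, outcomeMeasure_cylinder]
  simp [stringProb, LamString, tr_maxMixed hd]

theorem isStationaryMarkov_outcomeMeasure (hd : 0 < d) (hE : IsPOVM E) (hφ : ∀ i, ‖φ i‖ = 1)
    (hc0 : 0 < c) (hc : ∀ i, E i = (c : ℂ) • rankOne ℂ (φ i) (φ i)) :
    IsStationaryMarkov (outcomeMeasure hd U hE) (fun _ => c / d) (transitionMatrix U E φ) where
  pos _ := div_pos hc0 (Nat.cast_pos.2 hd)
  nonneg := transitionMatrix_nonneg hφ hc0 hc
  row_sum := transitionMatrix_row_sum hE hφ hc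
  stationary j := by rw [← Finset.mul_sum, transitionMatrix_col_sum hE hφ hc, mul_one]
  cylinder_cons i l := by
    rw [Measure.real, outcomeMeasure_cylinder, ENNReal.toReal_ofReal, stringProb_cons hφ hc0 hc]
    exact tr_re_nonneg (LamString_nonneg U E _ (maxMixed_nonneg d))

theorem irreducibleFamily_measOp_iff (hE : IsPOVM E) (hφ : ∀ i, ‖φ i‖ = 1)
    (hc0 : 0 < c) (hc : ∀ i, E i = (c : ℂ) • rankOne ℂ (φ i) (φ i)) :
    IrreducibleFamily (measOp U E) ↔ ¬ ∃ W : Submodule ℂ (H d), W ≠ ⊥ ∧ W ≠ ⊤ ∧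
      W.map ((U : Op d) : H d →ₗ[ℂ] H d) = W ∧ ∀ i, φ i ∈ W ∨ φ i ∈ Wᗮ := by
  refine not_congr (exists_congr fun W => and_congr_right fun _ => and_congr_right fun _ => ?_)
  constructor
  · intro h
    have hmem : ∀ i, ∀ x ∈ W, inner ℂ (φ i) ((U : Op d) x) ≠ (0 : ℂ) → φ i ∈ W := by
      intro i x hx hi
      have h1 := h i x hx
      rw [measOp_apply hφ hc0 hc] at h1
      refine (W.smul_mem_iff (mul_ne_zero ?_ hi)).1 h1
      exact Complex.ofReal_ne_zero.2 (Real.sqrt_pos.2 hc0).ne'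
    have hU : W.map ((U : Op d) : H d →ₗ[ℂ] H d) = W :=
      map_unitary_eq fun x hx => mem_of_forall_inner_ne_zero hE hc fun i => hmem i x hx
    refine ⟨hU, fun i => or_iff_not_imp_left.2 fun hi => ?_⟩
    -- Every vector of `W` is now some `U x` with `x ∈ W`, so a `φ i` that is not orthogonal to it
    -- would lie in `W` by `hmem`.
    rw [← hU, Submodule.mem_orthogonal']
    rintro _ ⟨x, hx, rfl⟩
    by_contra h0
    exact hi (hmem i x hx h0)
  · rintro ⟨hU, hW⟩ i x hx
    have hUx : (U : Op d) x ∈ W := hU ▸ Submodule.mem_map_of_mem hx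
    rw [measOp_apply hφ hc0 hc]
    rcases hW i with hi | hi
    · exact W.smul_mem _ hi
    · rw [Submodule.inner_left_of_mem_orthogonal hUx hi]
      simp

/-- A subspace `W` as in (iii) yields the closed set of all `i` with `φ i ∈ W`; a closed set `S`
yields the span of the `φ i` with `i ∈ S`. -/
theorem isIrreducible_transitionMatrix_iff (hE : IsPOVM E) (hφ : ∀ i, ‖φ i‖ = 1)
    (hc0 : 0 < c) (hc : ∀ i, E i = (c : ℂ) • rankOne ℂ (φ i) (φ i)) :
    (transitionMatrix U E φ).IsIrreducible ↔ ¬ ∃ W : Submodule ℂ (H d), W ≠ ⊥ ∧ W ≠ ⊤ ∧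
      W.map ((U : Op d) : H d →ₗ[ℂ] H d) = W ∧ ∀ i, φ i ∈ W ∨ φ i ∈ Wᗮ := by
  have htop : ∀ W : Submodule ℂ (H d), (∀ i, φ i ∈ W) → W = ⊤ := fun W h =>
    (Submodule.eq_top_iff'.2 fun x => mem_of_forall_inner_ne_zero hE hc fun i _ => h i)
  rw [isIrreducible_iff_forall_closed (transitionMatrix_nonneg hφ hc0 hc) fun i =>
    exists_pos_of_sum_eq_one (transitionMatrix_row_sum hE hφ hc i)]
  simp only [transitionMatrix_pos_iff hφ hc0 hc]
  constructor
  · rintro h ⟨W, hbot, hne, hU, hW⟩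
    have hS := h {i | φ i ∈ W} ?_ ?_
    · exact hne (htop W fun i => (hS ▸ Set.mem_univ i : i ∈ {i | φ i ∈ W}))
    -- If no `φ i` lay in `W`, all would lie in `Wᗮ`; as they span the whole space, `W` would be
    -- zero.
    · by_contra hempty
      refine hbot ((Submodule.orthogonal_eq_top_iff W).1 (htop Wᗮ fun i => ?_))
      exact (hW i).resolve_left fun hi => hempty ⟨i, hi⟩
    · intro i (hi : φ i ∈ W) j hij
      refine (hW j).resolve_right fun hj => hij ?_
      exact Submodule.inner_left_of_mem_orthogonal (hU ▸ Submodule.mem_map_of_mem hi) hj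
  · rintro h S ⟨a, ha⟩ hS
    by_contra hne
    obtain ⟨b, hb⟩ := (Set.ne_univ_iff_exists_notMem S).1 hne
    have hmem : ∀ i ∈ S, φ i ∈ Submodule.span ℂ (φ '' S) := fun i hi =>
      Submodule.subset_span ⟨i, hi, rfl⟩
    have hne0 : ∀ i, φ i ≠ 0 := fun i => norm_ne_zero_iff.1 (by rw [hφ]; exact one_ne_zero)
    have hU : (Submodule.span ℂ (φ '' S)).map ((U : Op d) : H d →ₗ[ℂ] H d) =
        Submodule.span ℂ (φ '' S) := by
      refine map_unitary_eq fun x hx => ?_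
      change x ∈ (Submodule.span ℂ (φ '' S)).comap ((U : Op d) : H d →ₗ[ℂ] H d)
      refine (Submodule.span_le.2 ?_) hx
      rintro _ ⟨i, hi, rfl⟩
      change (U : Op d) (φ i) ∈ Submodule.span ℂ (φ '' S)
      exact mem_of_forall_inner_ne_zero hE hc fun j hj => hmem j (hS i hi j hj)
    have horth : ∀ j ∉ S, φ j ∈ (Submodule.span ℂ (φ '' S))ᗮ := by
      intro j hj
      -- By `hU` the span is also generated by the `U (φ i)` with `i ∈ S`, and closedness of `S`
      -- makes `φ j` orthogonal to exactly these vectors.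
      rw [← hU, Submodule.map_span, ← Submodule.span_singleton_le_iff_mem]
      refine Submodule.isOrtho_span.2 ?_
      rintro _ rfl _ ⟨_, ⟨i, hi, rfl⟩, rfl⟩
      by_contra h0
      exact hj (hS i hi j h0)
    refine h ⟨Submodule.span ℂ (φ '' S), ?_, ?_, hU, fun i => ?_⟩
    · intro h0
      exact hne0 a ((Submodule.mem_bot ℂ).1 (h0 ▸ hmem a ha))
    · intro h1
      have h2 := horth b hb
      rw [h1, Submodule.top_orthogonal_eq_bot] at h2
      exact hne0 b ((Submodule.mem_bot ℂ).1 h2)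
    · by_cases hi : i ∈ S
      · exact .inl (hmem i hi)
      · exact .inr (horth i hi)

end Frame

end QTraj

theorem theorem10 {d k : ℕ} (hd : 2 ≤ d) (U : unitary (QTraj.Op d)) (E : Fin k → QTraj.Op d)
    (hE : QTraj.IsRankOnePOVM E) (φ : Fin k → QTraj.H d) (hφ : ∀ i, ‖φ i‖ = 1)
    (hEφ : ∀ i, LinearMap.range (E i : QTraj.H d →ₗ[ℂ] QTraj.H d) = Submodule.span ℂ {φ i}) :
    List.TFAE [
      Ergodic QTraj.shift (QTraj.outcomeMeasure (Nat.zero_lt_of_lt hd) U hE.toIsPOVM),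
      QTraj.IrreducibleFamily (QTraj.measOp U E),
      ¬ ∃ W : Submodule ℂ (QTraj.H d), W ≠ ⊥ ∧ W ≠ ⊤ ∧
        W.map ((U : QTraj.Op d) : QTraj.H d →ₗ[ℂ] QTraj.H d) = W ∧ ∀ i, φ i ∈ W ∨ φ i ∈ Wᗮ,
      (QTraj.transitionMatrix U E φ).IsIrreducible] := by
  obtain ⟨c, hc0, hc⟩ := hE.exists_eq_smul_rankOne hφ hEφ
  tfae_have 2 ↔ 3 := QTraj.irreducibleFamily_measOp_iff hE.toIsPOVM hφ hc0 hc
  tfae_have 4 ↔ 3 := QTraj.isIrreducible_transitionMatrix_iff hE.toIsPOVM hφ hc0 hc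
  tfae_have 1 ↔ 4 := (QTraj.isStationaryMarkov_outcomeMeasure (Nat.zero_lt_of_lt hd) hE.toIsPOVM
    hφ hc0 hc).ergodic_iff_isIrreducible
  tfae_finish
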